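/- **Lemma 3.7.** Let $0<a\le 1$ and $0<\alpha<1$, and let $\mathcal E$ be the real elliptic curve $$y^2=x^2+\frac{4x(x-a^2)(x-a^{-2})}{(a+1/a)^2(\alpha+1/\alpha)^2}$$ with its usual group law (identity at infinity). Assume that $(a^{-2},a^{-2})\in\mathcal E$ is a torsion point of (finite) order $d$. Put $\sigma(P)=P+(a^{-2},a^{-2})$, $(x_0,y_0)=\left(-1,-\frac{1-\alpha^2}{1+\alpha^2}\right)\in\mathcal E$, $$a(x,y)=\frac{a(a^2+1)(\alpha^2+1)}{2}\,\frac{y-x}{1-a^2x},$$ and define real constants $\gamma_1,\gamma_2$ by $$\gamma_1=-\left(\frac1d\sum_{j=0}^{d-1}a(\sigma^j(x_0,y_0))\right)^{1/2}\left(\frac1d\sum_{k=0}^{d-1}\frac1{a(\sigma^k(x_0,y_0))}\right)^{1/2},\qquad \gamma_2+a^2\gamma_1=-\tfrac12(a^2+1)(\alpha+1/\alpha).$$ Let $R(z)=(\alpha+1/\alpha)^2(1+a^2)^2-4(1-a^2z)(1-a^2/z)$, with zeros $x_1<x_2<0$. Then $R>0$ on $(x_1,x_2)$, the two integrals below converge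 absolutely, and $$\gamma_1\int_{x_1}^{x_2}\frac{dx}{x\,(x-a^{-2})\sqrt{R(x)}}=-\gamma_2\int_{x_1}^{x_2}\frac{dx}{(x-a^{-2})\sqrt{R(x)}},\qquad \sqrt{R(x)}>0 .$$ Moreover, this relation together with $\gamma_2+a^2\gamma_1=-\frac12(a^2+1)(\alpha+1/\alpha)$ determines $(\gamma_1,\gamma_2)$ uniquely; neither of these two equations involves $d$ explicitly. -/

import Mathlib

noncomputable section

namespace AztecFlow

/-- The real affine curve `y² = x² + 4x(x - a²)(x - a⁻²) / ((a + 1/a)² (α + 1/α)²)`. -/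
def curveE (a α : ℝ) : Set (ℝ × ℝ) :=
  {p | p.2 ^ 2 = p.1 ^ 2 + 4 * p.1 * (p.1 - a ^ 2) * (p.1 - 1 / a ^ 2) /
    ((a + 1 / a) ^ 2 * (α + 1 / α) ^ 2)}

/-- The factor `c = (a + 1/a)(α + 1/α)/2` of the linear change of variables `X = x`, `Y = c y`
which brings the curve into Weierstrass form. Being linear, it respects the chord and tangent
construction, hence the group law. -/
def yScale (a α : ℝ) : ℝ := (a + 1 / a) * (α + 1 / α) / 2

/-- The Weierstrass form `Y² = X³ + (c² - a² - a⁻²) X² + X` of the curve. -/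
def curveW (a α : ℝ) : WeierstrassCurve.Affine ℝ where
  a₁ := 0
  a₂ := yScale a α ^ 2 - a ^ 2 - 1 / a ^ 2
  a₃ := 0
  a₄ := 1
  a₆ := 0

theorem yScale_pos {a α : ℝ} (ha : 0 < a) (hα : 0 < α) : 0 < yScale a α := by
  unfold yScale
  positivity

/-- The change of variables identifies the two curves. -/
theorem mem_curveE_iff {a α : ℝ} (ha : 0 < a) (hα : 0 < α) (x y : ℝ) :
    (x, y) ∈ curveE a α ↔ (curveW a α).Equation x (yScale a α * y) := by
  have hc : yScale a α ≠ 0 := (yScale_pos ha hα).ne'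
  have ha' : a ≠ 0 := ha.ne'
  have hden : (a + 1 / a) ^ 2 * (α + 1 / α) ^ 2 = 4 * yScale a α ^ 2 := by
    unfold yScale
    ring
  rw [WeierstrassCurve.Affine.equation_iff]
  simp only [curveE, Set.mem_ofPred_eq, hden, curveW]
  generalize yScale a α = c at hc
  rw [← sub_eq_zero, ← sub_eq_zero (a := (c * y) ^ 2 + _ + _)]
  have : (c * y) ^ 2 + 0 * x * (c * y) + 0 * (c * y)
      - (x ^ 3 + (c ^ 2 - a ^ 2 - 1 / a ^ 2) * x ^ 2 + 1 * x + 0)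
      = c ^ 2 * (y ^ 2 - (x ^ 2 + 4 * x * (x - a ^ 2) * (x - 1 / a ^ 2) / (4 * c ^ 2))) := by
    field_simp
    ring
  rw [this]
  simp [hc]

theorem two_lt_a₂ {a α : ℝ} (ha : 0 < a) (hα : 0 < α) (hα1 : α < 1) :
    2 < (curveW a α).a₂ := by
  have h1 : 2 < α + 1 / α := by
    have : α + 1 / α - 2 = (1 - α) ^ 2 / α := by
      field_simp
      ring
    have : 0 < (1 - α) ^ 2 / α := by
      have : 0 < 1 - α := by linarith
      positivity
    linarith
  have h2 : 0 < a + 1 / a := by positivity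
  have h3 : (a + 1 / a) ^ 2 = a ^ 2 + 1 / a ^ 2 + 2 := by
    field_simp
    ring
  have h4 : a + 1 / a < yScale a α := by
    unfold yScale
    nlinarith
  have h5 : (a + 1 / a) ^ 2 < yScale a α ^ 2 := by gcongr
  simp only [curveW]
  linarith

theorem nonsingular_of_mem {a α : ℝ} (ha : 0 < a) (hα : 0 < α) (hα1 : α < 1) {x y : ℝ}
    (h : (x, y) ∈ curveE a α) : (curveW a α).Nonsingular x (yScale a α * y) := by
  refine (WeierstrassCurve.Affine.equation_iff_nonsingular_of_Δ_ne_zero ?_).1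
    ((mem_curveE_iff ha hα x y).1 h)
  have h2 := two_lt_a₂ ha hα hα1
  have : (curveW a α).Δ = 16 * ((curveW a α).a₂ ^ 2 - 4) := by
    simp only [WeierstrassCurve.Δ, WeierstrassCurve.b₂, WeierstrassCurve.b₄,
      WeierstrassCurve.b₆, WeierstrassCurve.b₈, curveW]
    ring
  rw [this]
  nlinarith

theorem shift_mem (a α : ℝ) : (1 / a ^ 2, 1 / a ^ 2) ∈ curveE a α := by
  simp [curveE]

theorem start_mem {a α : ℝ} (ha : 0 < a) (hα : 0 < α) :
    (-1, -((1 - α ^ 2) / (1 + α ^ 2))) ∈ curveE a α := by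
  have : a ≠ 0 := ha.ne'
  have : α ≠ 0 := hα.ne'
  have : 1 + α ^ 2 ≠ 0 := by positivity
  have : 1 + a ^ 2 ≠ 0 := by positivity
  have e1 : a + 1 / a = (1 + a ^ 2) / a := by
    field_simp
    ring
  have e2 : α + 1 / α = (1 + α ^ 2) / α := by
    field_simp
    ring
  simp only [curveE, Set.mem_ofPred_eq, e1, e2]
  field_simp
  ring

/-- The point of the elliptic curve with the coordinates `(x, y)` of `curveE`. -/
def pointE {a α : ℝ} (ha : 0 < a) (hα : 0 < α) (hα1 : α < 1) (x y : ℝ)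
    (h : (x, y) ∈ curveE a α) : (curveW a α).Point :=
  .some x (yScale a α * y) (nonsingular_of_mem ha hα hα1 h)

/-- The point `(a⁻², a⁻²)`. -/
def shiftPoint {a α : ℝ} (ha : 0 < a) (hα : 0 < α) (hα1 : α < 1) : (curveW a α).Point :=
  pointE ha hα hα1 (1 / a ^ 2) (1 / a ^ 2) (shift_mem a α)

/-- The initial point `(-1, -(1 - α²)/(1 + α²))` of the flow. -/
def startPoint {a α : ℝ} (ha : 0 < a) (hα : 0 < α) (hα1 : α < 1) : (curveW a α).Point :=
  pointE ha hα hα1 (-1) (-((1 - α ^ 2) / (1 + α ^ 2))) (start_mem ha hα)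

/-- The translation `σ(P) = P + (a⁻², a⁻²)` for the group law of the elliptic curve. -/
def sigma {a α : ℝ} (ha : 0 < a) (hα : 0 < α) (hα1 : α < 1)
    (P : (curveW a α).Point) : (curveW a α).Point :=
  P + shiftPoint ha hα hα1

/-- The function `a(x, y) = a(a² + 1)(α² + 1)/2 · (y - x)/(1 - a² x)`, in the coordinates of
`curveE` (so `y = Y / c`). The point at infinity, which is not on the oval `x < 0` where the
function is used, gets the value `0`. -/
def aFun (a α : ℝ) : (curveW a α).Point → ℝ
  | .zero => 0
  | .some x Y _ =>
    a * (a ^ 2 + 1) * (α ^ 2 + 1) / 2 * ((Y / yScale a α - x) / (1 - a ^ 2 * x))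

/-- `γ₁ = -((1/d) ∑_{j<d} a(σʲ(x₀,y₀)))^{1/2} ((1/d) ∑_{k<d} 1/a(σᵏ(x₀,y₀)))^{1/2}`. -/
def gamma₁ {a α : ℝ} (ha : 0 < a) (hα : 0 < α) (hα1 : α < 1) (d : ℕ) : ℝ :=
  -(√(1 / (d : ℝ) * ∑ j ∈ Finset.range d,
        aFun a α ((sigma ha hα hα1)^[j] (startPoint ha hα hα1))) *
    √(1 / (d : ℝ) * ∑ k ∈ Finset.range d,
        1 / aFun a α ((sigma ha hα hα1)^[k] (startPoint ha hα hα1))))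

/-- `γ₂`, determined by `γ₂ + a² γ₁ = -(a² + 1)(α + 1/α)/2`. -/
def gamma₂ {a α : ℝ} (ha : 0 < a) (hα : 0 < α) (hα1 : α < 1) (d : ℕ) : ℝ :=
  -(1 / 2) * (a ^ 2 + 1) * (α + 1 / α) - a ^ 2 * gamma₁ ha hα hα1 d

/-- The discriminant `R(z) = (α + 1/α)² (1 + a²)² - 4 (1 - a² z)(1 - a²/z)`. -/
def discR (a α z : ℝ) : ℝ :=
  (α + 1 / α) ^ 2 * (1 + a ^ 2) ^ 2 - 4 * (1 - a ^ 2 * z) * (1 - a ^ 2 / z)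

end AztecFlow

end

open MeasureTheory

noncomputable section

namespace AztecFlow

/-! Write `p = a⁻²`, `c = yScale a α`, `q = c p`, and let `λ(P)` be the slope of the chord from `P`
to the shift point `(p, q)` in Weierstrass coordinates. Then `a(P) = α (c - λ(P))` on the oval `X <
0` (`aFun_some`), so the orbit means of `a` are orbit means of `λ`.

Along the invariant vector field `λ` has derivative `X(P) - X(σP)`. Over a torsion orbit these
derivatives telescope to zero, so the orbit sum of `λ` is constant on the oval and may be averaged
against the invariant measure `dX / Y` (`IsOvalFlow.sum_chordSlope_eq`). Moreover `λ(σP) - λ(P)` and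
`λ + q / (X - p)` are multiples of logarithmic derivatives and have mean zero, so every term of the
orbit has the mean of `-q / (X - p)`. The order `d` then drops out of the orbit mean.

Translation by the two-torsion point `(0, 0)` replaces `a` by `α² a² / a`, so the mean of `1 / a` is
the mean of `a` divided by `(α a)²` (`aFun_mul_aFun_add`). This gives `γ₁` in terms of two integrals
over the oval (`gamma₁_mul`), and the substitution `x = m + r cos θ` identifies these with the
integrals involving `√R`. -/

/-! ### Chord translation on the oval. -/

/-- The slope of the chord through the points `P` and `(p, q)`. -/
def chordSlope (p q : ℝ) (P : ℝ × ℝ) : ℝ := (P.2 - q) / (P.1 - p)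

/-- Translation by `(p, q)` on the curve `Y² = X³ + A X² + X`, by the chord construction. -/
def translate (A p q : ℝ) (P : ℝ × ℝ) : ℝ × ℝ :=
  (chordSlope p q P ^ 2 - A - P.1 - p,
    -(chordSlope p q P * (chordSlope p q P ^ 2 - A - P.1 - p - P.1) + P.2))

/-- The bounded component of the real curve `Y² = X³ + A X² + X` with `A > 2`. -/
def oval (A : ℝ) : Set (ℝ × ℝ) :=
  {P | P.1 < 0 ∧ P.2 ^ 2 = P.1 ^ 3 + A * P.1 ^ 2 + P.1}

/-- The last identity comes from the cubic minus the square of the chord: this polynomial in `T` is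
`(T - X)(T - p)(T - X')`, with `X'` the new abscissa, and its derivative at `T = X` is read off in
two ways. -/
theorem chordSlope_translate {A p q : ℝ} (hp : 0 < p) (hq : q ^ 2 = p ^ 3 + A * p ^ 2 + p)
    {P : ℝ × ℝ} (hP : P ∈ oval A) :
    ((translate A p q P).1 = chordSlope p q P ^ 2 - A - P.1 - p) ∧
    (translate A p q P).2 = -(chordSlope p q P * ((translate A p q P).1 - P.1) + P.2) ∧
    chordSlope p q P * (P.1 - p) = P.2 - q ∧
    3 * P.1 ^ 2 + 2 * A * P.1 + 1 - 2 * chordSlope p q P * P.2 =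
      (P.1 - (translate A p q P).1) * (P.1 - p) := by
  obtain ⟨x, y⟩ := P
  obtain ⟨hx, hy⟩ := hP
  simp only at hx hy
  have hne : x - p ≠ 0 := by linarith
  have hs : chordSlope p q (x, y) * (x - p) = y - q := by
    simp only [chordSlope]
    field_simp
  refine ⟨rfl, rfl, hs, ?_⟩
  simp only [translate]
  generalize chordSlope p q (x, y) = l at hs
  obtain rfl : q = y - l * (x - p) := by linarith
  apply mul_right_cancel₀ hne
  linear_combination hq - hy

/-- By Vieta, the product of the three abscissae on the chord is the square of its intercept, so
`X'` has the sign of `X * p`. The intercept is nonzero: two points on a line through the origin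
would satisfy `x (p² + 1) = p (x² + 1)`, impossible for `x < 0 < p`. -/
theorem translate_mem_oval {A p q : ℝ} (hp : 0 < p) (hq : q ^ 2 = p ^ 3 + A * p ^ 2 + p)
    {P : ℝ × ℝ} (hP : P ∈ oval A) : translate A p q P ∈ oval A := by
  obtain ⟨h1, h2, h3, h4⟩ := chordSlope_translate hp hq hP
  obtain ⟨hx, hy⟩ := hP
  generalize chordSlope p q P = l at *
  generalize translate A p q P = Q at *
  obtain ⟨x, y⟩ := P
  obtain ⟨x', y'⟩ := Q
  simp only [oval, Set.mem_ofPred_eq] at *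
  have hcurve : y' ^ 2 = x' ^ 3 + A * x' ^ 2 + x' := by
    subst h2
    have hA : A = l ^ 2 - x' - x - p := by linarith
    subst hA
    linear_combination hy - (x' - x) * h4
  refine ⟨?_, hcurve⟩
  have hprod : x' * (x * p) = (y - l * x) ^ 2 := by
    have hA : A = l ^ 2 - x' - x - p := by linarith
    subst hA
    linear_combination -hy - x * h4
  have hxp : x * p < 0 := mul_neg_of_neg_of_pos hx hp
  have hnu : y - l * x ≠ 0 := by
    intro h0
    have hy' : y = l * x := by linarith
    have hq' : q = l * p := by linarith
    subst hy' hq'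
    have e1 : x * (l ^ 2 * x) = x * (x ^ 2 + A * x + 1) := by linarith
    have e2 : p * (l ^ 2 * p) = p * (p ^ 2 + A * p + 1) := by linarith
    have e1 := mul_left_cancel₀ hx.ne e1
    have e2 := mul_left_cancel₀ hp.ne' e2
    have : x * (p ^ 2 + 1) = p * (x ^ 2 + 1) := by linear_combination p * e1 - x * e2
    have : x * (p ^ 2 + 1) < 0 := mul_neg_of_neg_of_pos hx (by positivity)
    have : 0 < p * (x ^ 2 + 1) := by positivity
    linarith
  have : 0 < (y - l * x) ^ 2 := by positivity
  by_contra! h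
  nlinarith

theorem iterate_translate_mem_oval {A p q : ℝ} (hp : 0 < p)
    (hq : q ^ 2 = p ^ 3 + A * p ^ 2 + p) {P : ℝ × ℝ} (hP : P ∈ oval A) (j : ℕ) :
    (translate A p q)^[j] P ∈ oval A := by
  induction j with
  | zero => exact hP
  | succ j ih =>
    rw [Function.iterate_succ_apply']
    exact translate_mem_oval hp hq ih

/-! ### The invariant flow and means of the chord slope. -/

/-- A curve on the oval which is a reparametrised integral curve, with time change `w`, of the
invariant vector field `X' = 2Y`, `Y' = 3X² + 2AX + 1`. -/
structure IsOvalFlow (A : ℝ) (f : ℝ → ℝ × ℝ) (w : ℝ → ℝ) : Prop where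
  mem : ∀ t, f t ∈ oval A
  deriv_fst : ∀ t, HasDerivAt (fun s => (f s).1) (2 * (f t).2 * w t) t
  deriv_snd : ∀ t, HasDerivAt (fun s => (f s).2)
    ((3 * (f t).1 ^ 2 + 2 * A * (f t).1 + 1) * w t) t

section
variable {A p q : ℝ} {f : ℝ → ℝ × ℝ} {w : ℝ → ℝ}

theorem IsOvalFlow.deriv_chordSlope (hp : 0 < p) (hq : q ^ 2 = p ^ 3 + A * p ^ 2 + p)
    (hf : IsOvalFlow A f w) (t : ℝ) :
    HasDerivAt (fun s => chordSlope p q (f s)) (((f t).1 - (translate A p q (f t)).1) * w t) t := by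
  have hne : (f t).1 - p ≠ 0 := by
    have := (hf.mem t).1
    linarith
  obtain ⟨-, -, h3, h4⟩ := chordSlope_translate hp hq (hf.mem t)
  have := ((hf.deriv_snd t).sub_const q).div ((hf.deriv_fst t).sub_const p) hne
  refine this.congr_deriv ?_
  rw [div_eq_iff (pow_ne_zero 2 hne), ← h3]
  linear_combination (w t * ((f t).1 - p)) * h4

/-- This is the invariance of the vector field under translation: the time change `w` stays the
same. -/
theorem IsOvalFlow.translate (hp : 0 < p) (hq : q ^ 2 = p ^ 3 + A * p ^ 2 + p)
    (hf : IsOvalFlow A f w) : IsOvalFlow A (fun t => translate A p q (f t)) w := by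
  have d1 : ∀ t, HasDerivAt (fun s => (AztecFlow.translate A p q (f s)).1)
      (2 * (AztecFlow.translate A p q (f t)).2 * w t) t := by
    intro t
    obtain ⟨h1, h2, h3, h4⟩ := chordSlope_translate hp hq (hf.mem t)
    have := ((((hf.deriv_chordSlope hp hq t).pow 2).sub_const A).sub (hf.deriv_fst t)).sub_const p
    refine this.congr_deriv ?_
    rw [h2]
    push_cast
    ring
  refine ⟨fun t => translate_mem_oval hp hq (hf.mem t), d1, fun t => ?_⟩
  obtain ⟨h1, h2, h3, h4⟩ := chordSlope_translate hp hq (hf.mem t)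
  have := (((hf.deriv_chordSlope hp hq t).mul ((d1 t).sub (hf.deriv_fst t))).add
    (hf.deriv_snd t)).neg
  refine this.congr_deriv ?_
  simp only [Pi.sub_apply]
  generalize chordSlope p q (f t) = l at *
  generalize AztecFlow.translate A p q (f t) = Q at *
  have hA : A = l ^ 2 - Q.1 - (f t).1 - p := by linarith
  rw [h2]
  subst hA
  linear_combination (-2 * w t) * h4

theorem IsOvalFlow.iterate (hp : 0 < p) (hq : q ^ 2 = p ^ 3 + A * p ^ 2 + p)
    (hf : IsOvalFlow A f w) (j : ℕ) :
    IsOvalFlow A (fun t => (AztecFlow.translate A p q)^[j] (f t)) w := by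
  induction j with
  | zero => exact hf
  | succ j ih =>
    simp only [Function.iterate_succ_apply']
    exact ih.translate hp hq

theorem IsOvalFlow.continuous_fst (hf : IsOvalFlow A f w) : Continuous fun t => (f t).1 :=
  continuous_iff_continuousAt.2 fun t => (hf.deriv_fst t).continuousAt

theorem IsOvalFlow.continuous_snd (hf : IsOvalFlow A f w) : Continuous fun t => (f t).2 :=
  continuous_iff_continuousAt.2 fun t => (hf.deriv_snd t).continuousAt

theorem IsOvalFlow.sub_ne_zero (hp : 0 < p) (hf : IsOvalFlow A f w) (t : ℝ) :
    (f t).1 - p ≠ 0 := by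
  have := (hf.mem t).1
  linarith

theorem IsOvalFlow.continuous_chordSlope (hp : 0 < p) (hf : IsOvalFlow A f w) :
    Continuous fun t => chordSlope p q (f t) :=
  (hf.continuous_snd.sub continuous_const).div (hf.continuous_fst.sub continuous_const)
    (hf.sub_ne_zero hp)

/-- `Y / (X - p)` has mean zero over the oval, being a logarithmic derivative. -/
theorem IsOvalFlow.integral_snd_div (hp : 0 < p) (hf : IsOvalFlow A f w) (hw : Continuous w)
    {s t : ℝ} (hst : f s = f t) : ∫ u in s..t, (f u).2 / ((f u).1 - p) * w u = 0 := by
  have hd : ∀ u ∈ Set.uIcc s t, HasDerivAt (fun u => Real.log ((f u).1 - p) / 2)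
      ((f u).2 / ((f u).1 - p) * w u) u := by
    intro u _
    have := (((hf.deriv_fst u).sub_const p).log (hf.sub_ne_zero hp u)).div_const 2
    refine this.congr_deriv ?_
    ring
  rw [intervalIntegral.integral_eq_sub_of_hasDerivAt hd]
  · simp [hst]
  · exact (((hf.continuous_snd.div (hf.continuous_fst.sub continuous_const)
      (hf.sub_ne_zero hp)).mul hw).intervalIntegrable _ _)

theorem IsOvalFlow.integral_chordSlope (hp : 0 < p) (hf : IsOvalFlow A f w) (hw : Continuous w)
    {s t : ℝ} (hst : f s = f t) :
    ∫ u in s..t, chordSlope p q (f u) * w u = -q * ∫ u in s..t, 1 / ((f u).1 - p) * w u := by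
  have hc := hf.continuous_fst.sub (continuous_const (y := p))
  have e : ∀ u, chordSlope p q (f u) * w u =
      (f u).2 / ((f u).1 - p) * w u - q * (1 / ((f u).1 - p) * w u) := by
    intro u
    simp only [chordSlope]
    ring
  simp only [e]
  rw [intervalIntegral.integral_sub, hf.integral_snd_div hp hw hst,
    intervalIntegral.integral_const_mul]
  · ring
  · exact ((hf.continuous_snd.div hc (hf.sub_ne_zero hp)).mul hw).intervalIntegrable _ _
  · exact (continuous_const.mul
      ((continuous_const.div hc (hf.sub_ne_zero hp)).mul hw)).intervalIntegrable _ _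

/-- The mean of the chord slope over the oval is invariant under translation. -/
theorem IsOvalFlow.integral_chordSlope_translate (hp : 0 < p)
    (hq : q ^ 2 = p ^ 3 + A * p ^ 2 + p) (hf : IsOvalFlow A f w) (hw : Continuous w)
    {s t : ℝ} (hst : f s = f t) :
    ∫ u in s..t, chordSlope p q (AztecFlow.translate A p q (f u)) * w u =
      ∫ u in s..t, chordSlope p q (f u) * w u := by
  have hg := hf.translate hp hq
  rw [← sub_eq_zero, ← intervalIntegral.integral_sub]
  · have e : ∀ u, chordSlope p q (AztecFlow.translate A p q (f u)) * w u -
        chordSlope p q (f u) * w u = 2 * ((AztecFlow.translate A p q (f u)).2 /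
          ((AztecFlow.translate A p q (f u)).1 - p) * w u) := by
      intro u
      obtain ⟨-, h2, h3, -⟩ := chordSlope_translate hp hq (hf.mem u)
      have hne := hg.sub_ne_zero hp u
      -- The reflection of the translated point lies on the chord, so the slope can be recomputed
      -- from it.
      have hl : chordSlope p q (f u) = (-(AztecFlow.translate A p q (f u)).2 - q) /
          ((AztecFlow.translate A p q (f u)).1 - p) := by
        rw [eq_div_iff hne]
        linear_combination h2 + h3
      rw [hl, chordSlope]
      ring
    simp only [e]
    rw [intervalIntegral.integral_const_mul, hg.integral_snd_div hp hw, mul_zero]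
    simp only [hst]
  · exact ((hg.continuous_chordSlope hp).mul hw).intervalIntegrable _ _
  · exact ((hf.continuous_chordSlope hp).mul hw).intervalIntegrable _ _

/-- The sum of the chord slopes over an orbit of translation by a torsion point is constant on
the oval. -/
theorem IsOvalFlow.sum_chordSlope_eq (hp : 0 < p) (hq : q ^ 2 = p ^ 3 + A * p ^ 2 + p)
    (hf : IsOvalFlow A f w) {d : ℕ} (hd : ∀ t, (AztecFlow.translate A p q)^[d] (f t) = f t)
    (s t : ℝ) :
    ∑ j ∈ Finset.range d, chordSlope p q ((AztecFlow.translate A p q)^[j] (f s)) =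
      ∑ j ∈ Finset.range d, chordSlope p q ((AztecFlow.translate A p q)^[j] (f t)) := by
  have hder : ∀ u, HasDerivAt (fun u => ∑ j ∈ Finset.range d,
      chordSlope p q ((AztecFlow.translate A p q)^[j] (f u))) 0 u := by
    intro u
    have := HasDerivAt.fun_sum fun j (_ : j ∈ Finset.range d) =>
      (hf.iterate hp hq j).deriv_chordSlope hp hq u
    refine this.congr_deriv ?_
    simp only [← Function.iterate_succ_apply']
    -- The derivatives telescope, and the two ends agree by torsion.
    rw [← Finset.sum_mul, Finset.sum_range_sub' (fun j => ((AztecFlow.translate A p q)^[j] (f u)).1)]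
    simp [hd]
  exact is_const_of_deriv_eq_zero (fun u => (hder u).differentiableAt) (fun u => (hder u).deriv) s t

/-- Over an orbit of a torsion translation, the mean of the chord slope equals its mean over the
oval for the invariant measure. -/
theorem IsOvalFlow.sum_chordSlope_mul_integral (hp : 0 < p)
    (hq : q ^ 2 = p ^ 3 + A * p ^ 2 + p) (hf : IsOvalFlow A f w) (hw : Continuous w) {d : ℕ}
    (hd : ∀ t, (AztecFlow.translate A p q)^[d] (f t) = f t) {s t : ℝ} (hst : f s = f t) (v : ℝ) :
    (∑ j ∈ Finset.range d, chordSlope p q ((AztecFlow.translate A p q)^[j] (f v))) *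
      (∫ u in s..t, w u) = d * (-q * ∫ u in s..t, 1 / ((f u).1 - p) * w u) := by
  have hj : ∀ j, ∫ u in s..t, chordSlope p q ((AztecFlow.translate A p q)^[j] (f u)) * w u =
      -q * ∫ u in s..t, 1 / ((f u).1 - p) * w u := by
    intro j
    induction j with
    | zero => exact hf.integral_chordSlope hp hw hst
    | succ j ih =>
      simp only [Function.iterate_succ_apply']
      rw [(hf.iterate hp hq j).integral_chordSlope_translate hp hq hw (by simp only [hst]), ih]
  rw [← intervalIntegral.integral_const_mul]
  have e : ∀ u, (∑ j ∈ Finset.range d, chordSlope p q ((AztecFlow.translate A p q)^[j] (f v))) * w u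
      = ∑ j ∈ Finset.range d, chordSlope p q ((AztecFlow.translate A p q)^[j] (f u)) * w u := by
    intro u
    rw [hf.sum_chordSlope_eq hp hq hd v u, Finset.sum_mul]
  simp only [e]
  rw [intervalIntegral.integral_finsetSum]
  · simp [hj]
  · exact fun j _ => (((hf.iterate hp hq j).continuous_chordSlope hp).mul hw).intervalIntegrable _ _

end

/-! ### Angular parametrisation of the oval. -/

/-- The parametrisation of the oval by an angle; the roots of `X² + A X + 1` are `m ± r`. -/
def ovalParam (m r θ : ℝ) : ℝ × ℝ :=
  (m + r * Real.cos θ, r * Real.sin θ * √(-(m + r * Real.cos θ)))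

section
variable {A m r : ℝ}

theorem ovalParam_neg (hr : 0 < r) (hmr : m + r < 0) (θ : ℝ) : m + r * Real.cos θ < 0 := by
  have := Real.cos_le_one θ
  nlinarith

/-- The weight is forced by `2 Y w = -r sin θ`. The factor `sin θ` cancels, so `w` stays regular at
the turning points where `Y = 0`. -/
theorem isOvalFlow_ovalParam (hr : 0 < r) (hmr : m + r < 0) (hA : A = -2 * m)
    (h1 : m ^ 2 - r ^ 2 = 1) :
    IsOvalFlow A (ovalParam m r) (fun θ => -1 / (2 * √(-(m + r * Real.cos θ)))) := by
  have hX : ∀ θ, HasDerivAt (fun s => m + r * Real.cos s) (r * -Real.sin θ) θ := fun θ =>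
    ((Real.hasDerivAt_cos θ).const_mul r).const_add m
  have hpos : ∀ θ, 0 < -(m + r * Real.cos θ) := fun θ => by
    linarith [ovalParam_neg hr hmr θ]
  refine ⟨fun θ => ⟨ovalParam_neg hr hmr θ, ?_⟩, fun θ => ?_, fun θ => ?_⟩
  · simp only [ovalParam, mul_pow, Real.sq_sqrt (hpos θ).le, Real.sin_sq]
    subst hA
    linear_combination (m + r * Real.cos θ) * h1
  · refine (hX θ).congr_deriv ?_
    have := (Real.sqrt_pos.2 (hpos θ)).ne'
    simp only [ovalParam]
    field_simp
  · have hs := (Real.sqrt_pos.2 (hpos θ)).ne'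
    have := ((Real.hasDerivAt_sin θ).const_mul r).mul ((hX θ).neg.sqrt (hpos θ).ne')
    refine this.congr_deriv ?_
    have h2 := Real.sq_sqrt (hpos θ).le
    have h3 := Real.sin_sq_add_cos_sq θ
    simp only [ovalParam, Pi.neg_apply]
    generalize √(-(m + r * Real.cos θ)) = s at *
    subst hA
    field_simp
    linear_combination (2 * r * Real.cos θ) * h2 + r ^ 2 * h3 - h1

theorem exists_ovalParam_eq (hr : 0 < r) (hA : A = -2 * m)
    (h1 : m ^ 2 - r ^ 2 = 1) {P : ℝ × ℝ} (hP : P ∈ oval A) : ∃ θ, ovalParam m r θ = P := by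
  obtain ⟨x, y⟩ := P
  obtain ⟨hx, hy⟩ := hP
  simp only at hx hy
  subst hA
  have hs : √(-x) ^ 2 = -x := Real.sq_sqrt (by linarith)
  have hs0 : 0 < √(-x) := Real.sqrt_pos.2 (by linarith)
  -- The curve equation reads `y² = -x (r² - (x - m)²)`, a unit circle after rescaling.
  have key : ((x - m) / r) ^ 2 + (y / (r * √(-x))) ^ 2 = 1 := by
    rw [div_pow, div_pow, mul_pow, hs, hy]
    have := hx.ne
    field_simp
    linear_combination h1
  let z : ℂ := ⟨(x - m) / r, y / (r * √(-x))⟩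
  have hz : ‖z‖ = 1 := by
    rw [← sq_eq_sq₀ (norm_nonneg _) zero_le_one, Complex.sq_norm, Complex.normSq_apply]
    simp only [z]
    linarith
  have hz0 : z ≠ 0 := by
    rintro h
    simp [h] at hz
  have hc : Real.cos z.arg = (x - m) / r := by rw [Complex.cos_arg hz0, hz, div_one]
  have hsn : Real.sin z.arg = y / (r * √(-x)) := by rw [Complex.sin_arg, hz, div_one]
  refine ⟨z.arg, ?_⟩
  have e : m + r * Real.cos z.arg = x := by
    rw [hc]
    field_simp
    ring
  simp only [ovalParam, e, hsn]
  congr 1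
  field_simp

/-- Changing variables from `x` to the angle on the oval. -/
theorem integral_ovalParam (hr : 0 < r) {g h : ℝ → ℝ} (hh : Continuous h)
    (hg : ∀ θ ∈ Set.Ioo 0 Real.pi, r * Real.sin θ * g (m + r * Real.cos θ) = h θ) :
    IntervalIntegrable g volume (m - r) (m + r) ∧
      ∫ x in (m - r)..(m + r), g x = ∫ θ in (0 : ℝ)..Real.pi, h θ := by
  have hd : ∀ θ ∈ Set.Ioo 0 Real.pi, HasDerivWithinAt (fun θ => m + r * Real.cos θ)
      (r * -Real.sin θ) (Set.Ioo 0 Real.pi) θ := fun θ _ =>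
    (((Real.hasDerivAt_cos θ).const_mul r).const_add m).hasDerivWithinAt
  have hinj : Set.InjOn (fun θ => m + r * Real.cos θ) (Set.Ioo 0 Real.pi) := by
    intro s hs t ht hst
    have : Real.cos s = Real.cos t := by
      simpa [hr.ne'] using hst
    exact Real.injOn_cos ⟨hs.1.le, hs.2.le⟩ ⟨ht.1.le, ht.2.le⟩ this
  have himg : (fun θ => m + r * Real.cos θ) '' Set.Ioo 0 Real.pi = Set.Ioo (m - r) (m + r) := by
    ext x
    constructor
    · rintro ⟨θ, hθ, rfl⟩
      have h1 : Real.cos θ < 1 := by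
        simpa using Real.cos_lt_cos_of_nonneg_of_le_pi le_rfl hθ.2.le hθ.1
      have h2 : -1 < Real.cos θ := by
        simpa using Real.cos_lt_cos_of_nonneg_of_le_pi hθ.1.le le_rfl hθ.2
      constructor <;> simp only <;> nlinarith
    · rintro ⟨hl, hu⟩
      have h1 : -1 < (x - m) / r := by rw [lt_div_iff₀ hr]; linarith
      have h2 : (x - m) / r < 1 := by rw [div_lt_iff₀ hr]; linarith
      refine ⟨Real.arccos ((x - m) / r), ⟨Real.arccos_pos.2 h2, ?_⟩, ?_⟩
      · refine lt_of_le_of_ne (Real.arccos_le_pi _) fun h => ?_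
        rw [Real.arccos_eq_pi] at h
        linarith
      · simp only [Real.cos_arccos h1.le h2.le]
        field_simp
        ring
  have hcongr : Set.EqOn (fun θ => |r * -Real.sin θ| • g (m + r * Real.cos θ)) h
      (Set.Ioo 0 Real.pi) := by
    intro θ hθ
    have : 0 < r * Real.sin θ := mul_pos hr (Real.sin_pos_of_mem_Ioo hθ)
    simp only [mul_neg, abs_neg, abs_of_pos this, smul_eq_mul]
    exact hg θ hθ
  have hle : m - r ≤ m + r := by linarith
  constructor
  · rw [intervalIntegrable_iff_integrableOn_Ioo_of_le hle, ← himg,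
      integrableOn_image_iff_integrableOn_abs_deriv_smul measurableSet_Ioo hd hinj,
      integrableOn_congr_fun hcongr measurableSet_Ioo,
      ← intervalIntegrable_iff_integrableOn_Ioo_of_le Real.pi_pos.le]
    exact hh.intervalIntegrable _ _
  · rw [intervalIntegral.integral_of_le hle, integral_Ioc_eq_integral_Ioo, ← himg,
      integral_image_eq_integral_abs_deriv_smul measurableSet_Ioo hd hinj,
      setIntegral_congr_fun measurableSet_Ioo hcongr,
      intervalIntegral.integral_of_le Real.pi_pos.le, integral_Ioc_eq_integral_Ioo]

end

theorem integral_neg_self_of_even {h : ℝ → ℝ} (hh : Continuous h) (heven : ∀ t, h (-t) = h t)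
    (b : ℝ) : ∫ t in (-b)..b, h t = 2 * ∫ t in (0 : ℝ)..b, h t := by
  rw [← intervalIntegral.integral_add_adjacent_intervals (b := 0) (hh.intervalIntegrable _ _)
    (hh.intervalIntegrable _ _)]
  have := intervalIntegral.integral_comp_neg (a := 0) (b := b) h
  simp only [heven, neg_zero] at this
  rw [← this]
  ring

/-! ### Comparison with the group law, and the two-torsion symmetry. -/

section
variable {a α : ℝ} (ha : 0 < a) (hα : 0 < α) (hα1 : α < 1)
include ha

theorem shift_equation (α : ℝ) : (yScale a α * (1 / a ^ 2)) ^ 2 =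
    (1 / a ^ 2) ^ 3 + (curveW a α).a₂ * (1 / a ^ 2) ^ 2 + 1 / a ^ 2 := by
  simp only [curveW]
  field_simp
  ring

include hα hα1

theorem nonsingular_of_mem_oval {P : ℝ × ℝ} (hP : P ∈ oval (curveW a α).a₂) :
    (curveW a α).Nonsingular P.1 P.2 := by
  have hc := (yScale_pos ha hα).ne'
  have e : yScale a α * (P.2 / yScale a α) = P.2 := by field_simp
  have h := nonsingular_of_mem (x := P.1) (y := P.2 / yScale a α) ha hα hα1
    ((mem_curveE_iff ha hα _ _).2 ?_)
  · rwa [e] at h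
  · rw [e, WeierstrassCurve.Affine.equation_iff]
    have := hP.2
    simp only [curveW] at *
    linarith

omit ha hα hα1 in
/-- Chord addition of a point with a different `X`-coordinate is `translate`. -/
theorem some_add_some {P : ℝ × ℝ} {p q : ℝ} (hne : P.1 ≠ p)
    (h : (curveW a α).Nonsingular P.1 P.2) (h' : (curveW a α).Nonsingular p q) :
    ∃ h'', WeierstrassCurve.Affine.Point.some P.1 P.2 h + .some p q h' =
      .some (translate (curveW a α).a₂ p q P).1 (translate (curveW a α).a₂ p q P).2 h'' := by
  have e := WeierstrassCurve.Affine.Point.add_of_X_ne (h₁ := h) (h₂ := h') hne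
  have e1 : (curveW a α).addX P.1 p ((curveW a α).slope P.1 p P.2 q) =
      (translate (curveW a α).a₂ p q P).1 := by
    rw [WeierstrassCurve.Affine.slope_of_X_ne hne]
    simp [WeierstrassCurve.Affine.addX, translate, chordSlope, curveW]
  have e2 : (curveW a α).addY P.1 p P.2 ((curveW a α).slope P.1 p P.2 q) =
      (translate (curveW a α).a₂ p q P).2 := by
    rw [WeierstrassCurve.Affine.addY, WeierstrassCurve.Affine.negAddY, e1,
      WeierstrassCurve.Affine.slope_of_X_ne hne]
    simp [WeierstrassCurve.Affine.negY, translate, chordSlope, curveW]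
  simp only [e1, e2] at e
  exact ⟨_, e⟩

/-- The orbit stays in `X < 0 < a⁻²`, so every addition is a chord with distinct abscissae; neither
the tangent case nor infinity occurs. -/
theorem iterate_sigma (j : ℕ) {P : ℝ × ℝ} (hP : P ∈ oval (curveW a α).a₂)
    (h : (curveW a α).Nonsingular P.1 P.2) :
    ∃ h', (sigma ha hα hα1)^[j] (.some P.1 P.2 h) = .some
      ((translate (curveW a α).a₂ (1 / a ^ 2) (yScale a α * (1 / a ^ 2)))^[j] P).1
      ((translate (curveW a α).a₂ (1 / a ^ 2) (yScale a α * (1 / a ^ 2)))^[j] P).2 h' := by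
  induction j generalizing P with
  | zero => exact ⟨h, rfl⟩
  | succ j ih =>
    have hp : 0 < 1 / a ^ 2 := by positivity
    have hne : P.1 ≠ 1 / a ^ 2 := by linarith [hP.1]
    obtain ⟨h1, e1⟩ := some_add_some hne h
      (nonsingular_of_mem ha hα hα1 (shift_mem a α))
    obtain ⟨h2, e2⟩ := ih (translate_mem_oval hp (shift_equation ha α) hP) h1
    refine ⟨h2, ?_⟩
    rw [Function.iterate_succ_apply]
    exact (congrArg (sigma ha hα hα1)^[j] e1).trans e2

/-- The shift point lies on the line `Y = c X`, hence `c (X - p) - (Y - q) = c X - Y`. -/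
theorem aFun_some {P : ℝ × ℝ} (hP : P ∈ oval (curveW a α).a₂)
    (h : (curveW a α).Nonsingular P.1 P.2) :
    aFun a α (.some P.1 P.2 h) =
      α * (yScale a α - chordSlope (1 / a ^ 2) (yScale a α * (1 / a ^ 2)) P) := by
  have hc := (yScale_pos ha hα).ne'
  have hx := hP.1
  have h1 : 1 - a ^ 2 * P.1 ≠ 0 := by nlinarith [sq_nonneg a]
  have h2 : P.1 - 1 / a ^ 2 ≠ 0 := by
    have : 0 < 1 / a ^ 2 := by positivity
    linarith
  have h3 : a ^ 2 * P.1 - 1 ≠ 0 := by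
    intro h0
    apply h1
    linarith
  have h4 : a * (a ^ 2 + 1) * (α ^ 2 + 1) / 2 = a ^ 2 * α * yScale a α := by
    unfold yScale
    field_simp
  simp only [aFun, chordSlope, h4]
  generalize yScale a α = c at *
  field_simp
  ring

omit hα hα1 in
theorem iterate_sigma_order (hα : 0 < α) (hα1 : α < 1) (P : (curveW a α).Point) :
    (sigma ha hα hα1)^[addOrderOf (shiftPoint ha hα hα1)] P = P := by
  have : sigma ha hα hα1 = fun Q => Q + shiftPoint ha hα hα1 := rfl
  rw [this, add_right_iterate]
  simp [addOrderOf_nsmul_eq_zero]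

theorem translate_iterate_order {P : ℝ × ℝ} (hP : P ∈ oval (curveW a α).a₂) :
    (translate (curveW a α).a₂ (1 / a ^ 2)
      (yScale a α * (1 / a ^ 2)))^[addOrderOf (shiftPoint ha hα hα1)] P = P := by
  obtain ⟨h', e⟩ := iterate_sigma ha hα hα1 (addOrderOf (shiftPoint ha hα hα1)) hP
    (nonsingular_of_mem_oval ha hα hα1 hP)
  rw [iterate_sigma_order] at e
  injection e with e1 e2
  exact Prod.ext e1.symm e2.symm

/-- The two-torsion point `(0, 0)` is a nonsingular point of the curve. -/
theorem nonsingular_zero : (curveW a α).Nonsingular 0 0 := by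
  have h := nonsingular_of_mem (x := 0) (y := 0) ha hα hα1 (by simp [curveE])
  simpa using h

omit ha hα hα1 in
theorem translate_zero {P : ℝ × ℝ} (hP : P ∈ oval (curveW a α).a₂) :
    translate (curveW a α).a₂ 0 0 P = (1 / P.1, -P.2 / P.1 ^ 2) := by
  have hx := hP.1.ne
  have hy := hP.2
  simp only [translate, chordSlope, sub_zero]
  have e : (P.2 / P.1) ^ 2 - (curveW a α).a₂ - P.1 = 1 / P.1 := by
    rw [div_pow, hy]
    field_simp
    ring
  rw [e]
  ext
  · rfl
  · simp only
    field_simp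
    ring

/-- Translation by the two-torsion point `(0, 0)` inverts `a` up to a constant. -/
theorem aFun_mul_aFun_add {P : ℝ × ℝ} (hP : P ∈ oval (curveW a α).a₂)
    (h : (curveW a α).Nonsingular P.1 P.2) :
    aFun a α (.some P.1 P.2 h) *
      aFun a α (.some P.1 P.2 h + .some 0 0 (nonsingular_zero ha hα hα1)) = α ^ 2 * a ^ 2 := by
  obtain ⟨h'', e⟩ := some_add_some hP.1.ne h (nonsingular_zero ha hα hα1)
  have hx := hP.1
  have hy := hP.2
  have hp : 0 < 1 / a ^ 2 := by positivity
  have hQ : translate (curveW a α).a₂ 0 0 P ∈ oval (curveW a α).a₂ := by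
    rw [translate_zero hP]
    refine ⟨one_div_neg.2 hx, ?_⟩
    simp only
    rw [div_pow, neg_sq, hy]
    have := hx.ne
    field_simp
    ring
  rw [e, aFun_some ha hα hα1 hP, aFun_some ha hα hα1 hQ, translate_zero hP]
  simp only [chordSlope]
  have hA : (curveW a α).a₂ = yScale a α ^ 2 - a ^ 2 - 1 / a ^ 2 := rfl
  rw [hA] at hy
  generalize yScale a α = c at *
  obtain ⟨x, y⟩ := P
  simp only at *
  have h0 := hx.ne
  have h1 : a ^ 2 * x - 1 ≠ 0 := by nlinarith [sq_nonneg a]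
  have h2 : a ^ 2 - x ≠ 0 := by nlinarith [sq_nonneg a]
  have e1 : c - (y - c * (1 / a ^ 2)) / (x - 1 / a ^ 2) = a ^ 2 * (c * x - y) / (a ^ 2 * x - 1) := by
    have : x - 1 / a ^ 2 ≠ 0 := by linarith
    field_simp
    ring
  have e2 : c - (-y / x ^ 2 - c * (1 / a ^ 2)) / (1 / x - 1 / a ^ 2) =
      a ^ 2 * (c * x + y) / (x * (a ^ 2 - x)) := by
    have : 1 / x - 1 / a ^ 2 ≠ 0 := by
      have := one_div_neg.2 hx
      linarith
    field_simp
    ring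
  -- The product contains `c² x² - y²`, which on the curve equals `-x (x - a²)(x - a⁻²)` and cancels
  -- the denominators.
  rw [e1, e2]
  field_simp
  field_simp at hy
  linear_combination (-1) * hy

end

/-! ### Evaluation of `gamma₁`. -/

section
variable {a α : ℝ} (ha : 0 < a) (hα : 0 < α) (hα1 : α < 1)
include ha hα

theorem startPoint_mem_oval : ((-1 : ℝ), yScale a α * -((1 - α ^ 2) / (1 + α ^ 2))) ∈
    oval (curveW a α).a₂ := by
  have h := (mem_curveE_iff ha hα _ _).1 (start_mem ha hα)
  rw [WeierstrassCurve.Affine.equation_iff] at h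
  refine ⟨by norm_num, ?_⟩
  simp only [curveW] at *
  linarith

include hα1

/-- Translation by `(0, 0)` sends `(X, Y)` to `(1 / X, -Y / X²)`, and here `X = -1`. The translated
orbit thus starts at another point of the oval. -/
theorem startPoint_add_zero : startPoint ha hα hα1 + .some 0 0 (nonsingular_zero ha hα hα1) =
    -startPoint ha hα hα1 := by
  obtain ⟨h'', e⟩ := some_add_some (P := (-1, yScale a α * -((1 - α ^ 2) / (1 + α ^ 2)))) (p := 0)
    (by norm_num) (nonsingular_of_mem ha hα hα1 (start_mem ha hα)) (nonsingular_zero ha hα hα1)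
  refine e.trans ?_
  rw [startPoint, pointE, WeierstrassCurve.Affine.Point.neg_some]
  congr 1
  · rw [translate_zero (startPoint_mem_oval ha hα)]
    simp
  · rw [translate_zero (startPoint_mem_oval ha hα)]
    simp [WeierstrassCurve.Affine.negY, curveW]

theorem sum_aFun {P : ℝ × ℝ} (hP : P ∈ oval (curveW a α).a₂)
    (h : (curveW a α).Nonsingular P.1 P.2) (d : ℕ) :
    ∑ j ∈ Finset.range d, aFun a α ((sigma ha hα hα1)^[j] (.some P.1 P.2 h)) =
      α * (d * yScale a α - ∑ j ∈ Finset.range d,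
        chordSlope (1 / a ^ 2) (yScale a α * (1 / a ^ 2))
          ((translate (curveW a α).a₂ (1 / a ^ 2) (yScale a α * (1 / a ^ 2)))^[j] P)) := by
  have hp : 0 < 1 / a ^ 2 := by positivity
  have e : ∀ j, aFun a α ((sigma ha hα hα1)^[j] (.some P.1 P.2 h)) = α * (yScale a α -
      chordSlope (1 / a ^ 2) (yScale a α * (1 / a ^ 2))
        ((translate (curveW a α).a₂ (1 / a ^ 2) (yScale a α * (1 / a ^ 2)))^[j] P)) := by
    intro j
    obtain ⟨h', e'⟩ := iterate_sigma ha hα hα1 j hP h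
    rw [e', aFun_some ha hα hα1 (iterate_translate_mem_oval hp (shift_equation ha α) hP j)]
  simp [e, ← Finset.mul_sum, Finset.sum_sub_distrib]

/-- Inverting `a` costs a translation by `(0, 0)`, which commutes with `sigma` and can be moved to
the starting point. -/
theorem sum_one_div_aFun {P : ℝ × ℝ} (hP : P ∈ oval (curveW a α).a₂)
    (h : (curveW a α).Nonsingular P.1 P.2) (d : ℕ) :
    ∑ j ∈ Finset.range d, 1 / aFun a α ((sigma ha hα hα1)^[j] (.some P.1 P.2 h)) =
      (∑ j ∈ Finset.range d, aFun a α ((sigma ha hα hα1)^[j]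
        (.some P.1 P.2 h + .some 0 0 (nonsingular_zero ha hα hα1)))) / (α ^ 2 * a ^ 2) := by
  have hp : 0 < 1 / a ^ 2 := by positivity
  rw [Finset.sum_div]
  refine Finset.sum_congr rfl fun j _ => ?_
  have hadd : ∀ Q, (sigma ha hα hα1)^[j] (Q + .some 0 0 (nonsingular_zero ha hα hα1)) =
      (sigma ha hα hα1)^[j] Q + .some 0 0 (nonsingular_zero ha hα hα1) := by
    intro Q
    have : sigma ha hα hα1 = fun Q => Q + shiftPoint ha hα hα1 := rfl
    rw [this, add_right_iterate]
    exact add_right_comm _ _ _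
  obtain ⟨h', e'⟩ := iterate_sigma ha hα hα1 j hP h
  rw [hadd, e']
  have key := aFun_mul_aFun_add ha hα hα1
    (iterate_translate_mem_oval hp (shift_equation ha α) hP j) h'
  have hne : α ^ 2 * a ^ 2 ≠ 0 := by positivity
  have h1 := left_ne_zero_of_mul (key ▸ hne)
  rw [div_eq_div_iff h1 hne, ← key]
  ring

-- On the curve this says `R = 4 a² Y² / X²`, so `dx / (x √R)` is, up to a constant, the invariant
-- differential.
omit hα1 in
theorem discR_eq {z : ℝ} (hz : z ≠ 0) :
    discR a α z = 4 * a ^ 2 * (z ^ 2 + (curveW a α).a₂ * z + 1) / z := by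
  simp only [discR, curveW, yScale]
  field_simp
  ring

/-- The invariant period and the integral of `1 / (X - a⁻²)` over half of the oval determine
`γ₁`. -/
theorem gamma₁_mul {m r : ℝ} (hr : 0 < r) (hmr : m + r < 0) (hA : (curveW a α).a₂ = -2 * m)
    (h1 : m ^ 2 - r ^ 2 = 1) {d : ℕ} (hd : 0 < d) (htors : addOrderOf (shiftPoint ha hα hα1) = d)
    {J₀ J₁ : ℝ} (hJ₀ : J₀ = ∫ θ in (0 : ℝ)..Real.pi, 1 / √(-(m + r * Real.cos θ)))
    (hJ₁ : J₁ = ∫ θ in (0 : ℝ)..Real.pi,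
      1 / √(-(m + r * Real.cos θ)) / (m + r * Real.cos θ - 1 / a ^ 2))
    (hpos : 0 < J₀) (hnonneg : 0 ≤ J₀ + 1 / a ^ 2 * J₁) :
    gamma₁ ha hα hα1 d * (a * J₀) = -yScale a α * (J₀ + 1 / a ^ 2 * J₁) := by
  have hp : 0 < 1 / a ^ 2 := by positivity
  have hc := yScale_pos ha hα
  have hX : ∀ θ, 0 < -(m + r * Real.cos θ) := fun θ => by linarith [ovalParam_neg hr hmr θ]
  have hs : ∀ θ, √(-(m + r * Real.cos θ)) ≠ 0 := fun θ => (Real.sqrt_pos.2 (hX θ)).ne'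
  have hu : Continuous fun θ => 1 / √(-(m + r * Real.cos θ)) :=
    continuous_const.div (by fun_prop) hs
  have huX : Continuous fun θ =>
      1 / √(-(m + r * Real.cos θ)) / (m + r * Real.cos θ - 1 / a ^ 2) :=
    hu.div (by fun_prop) fun θ => by linarith [hX θ]
  have hflow := isOvalFlow_ovalParam hr hmr hA h1
  have hw : Continuous fun θ => -1 / (2 * √(-(m + r * Real.cos θ))) :=
    continuous_const.div (by fun_prop) fun θ => by simpa using hs θ
  have hend : ovalParam m r (-Real.pi) = ovalParam m r Real.pi := by simp [ovalParam]
  -- The factor `1 / 2` in the weight cancels the doubling from half the oval to the whole loop.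
  have i0 : ∫ θ in (-Real.pi)..Real.pi, -1 / (2 * √(-(m + r * Real.cos θ))) = -J₀ := by
    have e : ∀ θ, -1 / (2 * √(-(m + r * Real.cos θ))) =
        (-1 / 2) * (1 / √(-(m + r * Real.cos θ))) := fun θ => by ring
    simp only [e]
    rw [intervalIntegral.integral_const_mul, integral_neg_self_of_even hu (by simp), hJ₀]
    ring
  have i1 : ∫ θ in (-Real.pi)..Real.pi, 1 / ((ovalParam m r θ).1 - 1 / a ^ 2) *
      (-1 / (2 * √(-(m + r * Real.cos θ)))) = -J₁ := by
    have e : ∀ θ, 1 / ((ovalParam m r θ).1 - 1 / a ^ 2) *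
        (-1 / (2 * √(-(m + r * Real.cos θ)))) = (-1 / 2) *
          (1 / √(-(m + r * Real.cos θ)) / (m + r * Real.cos θ - 1 / a ^ 2)) := fun θ => by
      simp only [ovalParam]
      ring
    simp only [e]
    rw [intervalIntegral.integral_const_mul, integral_neg_self_of_even huX (by simp), hJ₁]
    ring
  have hper := fun θ => translate_iterate_order ha hα hα1 (hflow.mem θ)
  rw [htors] at hper
  have hsum : ∀ {P : ℝ × ℝ} (_ : P ∈ oval (curveW a α).a₂)
      (h : (curveW a α).Nonsingular P.1 P.2),
      ∑ j ∈ Finset.range d, aFun a α ((sigma ha hα hα1)^[j] (.some P.1 P.2 h)) =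
        d * (α * yScale a α * ((J₀ + 1 / a ^ 2 * J₁) / J₀)) := by
    intro P hP h
    rw [sum_aFun ha hα hα1 hP h]
    obtain ⟨θ, rfl⟩ := exists_ovalParam_eq hr hA h1 hP
    have := hflow.sum_chordSlope_mul_integral hp (shift_equation ha α) hw hper hend θ
    rw [i0, i1] at this
    apply mul_right_cancel₀ hpos.ne'
    rw [mul_assoc (d : ℝ), mul_assoc (α * _), div_mul_cancel₀ _ hpos.ne']
    linear_combination α * this
  have hd' : (d : ℝ) ≠ 0 := by positivity
  have hstart := startPoint_mem_oval ha hα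
  have s1 : 1 / (d : ℝ) * ∑ j ∈ Finset.range d, aFun a α ((sigma ha hα hα1)^[j]
      (startPoint ha hα hα1)) = α * yScale a α * ((J₀ + 1 / a ^ 2 * J₁) / J₀) := by
    have := hsum hstart (nonsingular_of_mem ha hα hα1 (start_mem ha hα))
    rw [startPoint, pointE, this]
    field_simp
  have s2 : 1 / (d : ℝ) * ∑ j ∈ Finset.range d, 1 / aFun a α ((sigma ha hα hα1)^[j]
      (startPoint ha hα hα1)) =
        α * yScale a α * ((J₀ + 1 / a ^ 2 * J₁) / J₀) / (α * a) ^ 2 := by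
    have e := sum_one_div_aFun ha hα hα1 hstart (nonsingular_of_mem ha hα hα1 (start_mem ha hα)) d
    have hstart' : ((-1 : ℝ), (curveW a α).negY (-1)
        (yScale a α * -((1 - α ^ 2) / (1 + α ^ 2)))) ∈ oval (curveW a α).a₂ := by
      refine ⟨by norm_num, ?_⟩
      have := hstart.2
      simp only [WeierstrassCurve.Affine.negY, curveW] at *
      linarith
    have h2 := hsum hstart' (nonsingular_of_mem_oval ha hα hα1 hstart')
    have e2 := startPoint_add_zero ha hα hα1
    rw [startPoint, pointE, WeierstrassCurve.Affine.Point.neg_some] at e2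
    rw [startPoint, pointE, e, e2, h2]
    field_simp
  -- The two means are `F` and `F / (α a)²`; for `F ≥ 0` the product of their square roots is `F /
  -- (α a)`.
  have hF : 0 ≤ α * yScale a α * ((J₀ + 1 / a ^ 2 * J₁) / J₀) := by positivity
  have haα : 0 < α * a := by positivity
  rw [gamma₁, s1, s2, Real.sqrt_div hF, Real.sqrt_sq haα.le, ← mul_div_assoc,
    Real.mul_self_sqrt hF]
  field_simp

end

end AztecFlow

end

/-! ### The integrals with `√R` and the relation between the constants. -/

theorem lemma3p7 (a α : ℝ) (ha : 0 < a) (ha1 : a ≤ 1) (hα : 0 < α) (hα1 : α < 1)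
    (d : ℕ) (hd : 0 < d) (htors : addOrderOf (AztecFlow.shiftPoint ha hα hα1) = d)
    (x₁ x₂ : ℝ) (h₁₂ : x₁ < x₂) (hx₂ : x₂ < 0)
    (hR₁ : AztecFlow.discR a α x₁ = 0) (hR₂ : AztecFlow.discR a α x₂ = 0) :
    -- the integrands are well defined and integrable
    (∀ x ∈ Set.Ioo x₁ x₂, 0 < AztecFlow.discR a α x) ∧
    IntervalIntegrable (fun x : ℝ => 1 / (x * (x - 1 / a ^ 2) * √(AztecFlow.discR a α x)))
      MeasureTheory.volume x₁ x₂ ∧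
    IntervalIntegrable (fun x : ℝ => 1 / ((x - 1 / a ^ 2) * √(AztecFlow.discR a α x)))
      MeasureTheory.volume x₁ x₂ ∧
    -- the relation between the two constants
    AztecFlow.gamma₁ ha hα hα1 d *
        (∫ x in x₁..x₂, 1 / (x * (x - 1 / a ^ 2) * √(AztecFlow.discR a α x))) =
      -AztecFlow.gamma₂ ha hα hα1 d *
        (∫ x in x₁..x₂, 1 / ((x - 1 / a ^ 2) * √(AztecFlow.discR a α x))) ∧
    -- together with the second defining equation, which does not involve the order `d` either,
    -- the relation determines both constants
    (∀ g₁ g₂ : ℝ, g₂ + a ^ 2 * g₁ = -(1 / 2) * (a ^ 2 + 1) * (α + 1 / α) →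
      g₁ * (∫ x in x₁..x₂, 1 / (x * (x - 1 / a ^ 2) * √(AztecFlow.discR a α x))) =
        -g₂ * (∫ x in x₁..x₂, 1 / ((x - 1 / a ^ 2) * √(AztecFlow.discR a α x))) →
      g₁ = AztecFlow.gamma₁ ha hα hα1 d ∧ g₂ = AztecFlow.gamma₂ ha hα hα1 d) := by
  obtain ⟨m, hm⟩ : ∃ m, m = (x₁ + x₂) / 2 := ⟨_, rfl⟩
  obtain ⟨r, hr'⟩ : ∃ r, r = (x₂ - x₁) / 2 := ⟨_, rfl⟩
  obtain rfl : x₁ = m - r := by linarith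
  obtain rfl : x₂ = m + r := by linarith
  have hr : 0 < r := by linarith
  have ha2 : a ^ 2 ≠ 0 := by positivity
  have hp : 0 < 1 / a ^ 2 := by positivity
  have hroot : ∀ {z : ℝ}, z < 0 → AztecFlow.discR a α z = 0 →
      z ^ 2 + (AztecFlow.curveW a α).a₂ * z + 1 = 0 := by
    intro z hz h
    rw [AztecFlow.discR_eq ha hα hz.ne] at h
    simpa [ha.ne', hz.ne] using h
  have hz1 := hroot (by linarith) hR₁
  have hz2 := hroot hx₂ hR₂
  have hA : (AztecFlow.curveW a α).a₂ = -2 * m := by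
    have : r * ((AztecFlow.curveW a α).a₂ + 2 * m) = 0 := by
      linear_combination (hz2 - hz1) / 2
    rcases mul_eq_zero.1 this with h | h <;> linarith
  have h1 : m ^ 2 - r ^ 2 = 1 := by
    rw [hA] at hz2
    linear_combination -hz2
  have hR : ∀ {z : ℝ}, z < 0 →
      AztecFlow.discR a α z = 4 * a ^ 2 * ((r ^ 2 - (z - m) ^ 2) / -z) := by
    intro z hz
    rw [AztecFlow.discR_eq ha hα hz.ne, hA]
    have := hz.ne
    field_simp
    linear_combination -h1
  have hX : ∀ θ, m + r * Real.cos θ < 0 := AztecFlow.ovalParam_neg hr hx₂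
  have hs : ∀ θ, 0 < √(-(m + r * Real.cos θ)) := fun θ =>
    Real.sqrt_pos.2 (by linarith [hX θ])
  have hsq : ∀ θ, √(-(m + r * Real.cos θ)) ^ 2 = -(m + r * Real.cos θ) := fun θ =>
    Real.sq_sqrt (by linarith [hX θ])
  have hXp : ∀ θ, m + r * Real.cos θ - 1 / a ^ 2 < 0 := fun θ => by linarith [hX θ]
  have hu : Continuous fun θ => 1 / √(-(m + r * Real.cos θ)) :=
    continuous_const.div (by fun_prop) fun θ => (hs θ).ne'
  have huX : Continuous fun θ =>
      1 / √(-(m + r * Real.cos θ)) / (m + r * Real.cos θ - 1 / a ^ 2) :=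
    hu.div (by fun_prop) fun θ => (hXp θ).ne
  have huX' : Continuous fun θ => 1 / a ^ 2 *
      (1 / √(-(m + r * Real.cos θ)) / (m + r * Real.cos θ - 1 / a ^ 2)) :=
    continuous_const.mul huX
  have hsqrt : ∀ θ ∈ Set.Ioo 0 Real.pi, √(AztecFlow.discR a α (m + r * Real.cos θ)) =
      2 * a * (r * Real.sin θ) / √(-(m + r * Real.cos θ)) := by
    intro θ hθ
    have hsin := Real.sin_pos_of_mem_Ioo hθ
    have hsθ := hs θ
    rw [hR (hX θ), Real.sqrt_eq_iff_eq_sq ?_ (by positivity), div_pow, hsq, mul_pow, mul_pow r,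
      Real.sin_sq]
    · ring
    · have e : r ^ 2 - (m + r * Real.cos θ - m) ^ 2 = (r * Real.sin θ) ^ 2 := by
        rw [mul_pow, Real.sin_sq]
        ring
      have := hX θ
      rw [e]
      exact mul_nonneg (by positivity) (div_nonneg (sq_nonneg _) (by linarith))
  obtain ⟨int1, I1⟩ := AztecFlow.integral_ovalParam (m := m) hr
    (g := fun x => 1 / (x * (x - 1 / a ^ 2) * √(AztecFlow.discR a α x)))
    (h := fun θ => (-1 / (2 * a)) *
      (1 / √(-(m + r * Real.cos θ)) / (m + r * Real.cos θ - 1 / a ^ 2)))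
    (continuous_const.mul huX) (by
      intro θ hθ
      have hsin := (Real.sin_pos_of_mem_Ioo hθ).ne'
      have hsθ := (hs θ).ne'
      have hXθ := (hX θ).ne
      have hXpθ := (hXp θ).ne
      rw [hsqrt θ hθ]
      have hq := hsq θ
      generalize m + r * Real.cos θ - 1 / a ^ 2 = b at *
      generalize √(-(m + r * Real.cos θ)) = s at *
      generalize m + r * Real.cos θ = x at *
      field_simp
      linear_combination hq)
  obtain ⟨int2, I2⟩ := AztecFlow.integral_ovalParam (m := m) hr
    (g := fun x => 1 / ((x - 1 / a ^ 2) * √(AztecFlow.discR a α x)))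
    (h := fun θ => (-1 / (2 * a)) * (1 / √(-(m + r * Real.cos θ)) + 1 / a ^ 2 *
      (1 / √(-(m + r * Real.cos θ)) / (m + r * Real.cos θ - 1 / a ^ 2))))
    (continuous_const.mul (hu.add huX')) (by
      intro θ hθ
      have hsin := (Real.sin_pos_of_mem_Ioo hθ).ne'
      have hsθ := (hs θ).ne'
      have hXpθ := (hXp θ).ne
      rw [hsqrt θ hθ]
      have hq := hsq θ
      have hb : m + r * Real.cos θ = (m + r * Real.cos θ - 1 / a ^ 2) + 1 / a ^ 2 := by ring
      generalize √(-(m + r * Real.cos θ)) = s at *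
      generalize m + r * Real.cos θ - 1 / a ^ 2 = b at *
      rw [hb] at hq
      field_simp
      field_simp at hq
      linear_combination hq)
  obtain ⟨J₀, hJ₀⟩ : ∃ J, J = ∫ θ in (0 : ℝ)..Real.pi, 1 / √(-(m + r * Real.cos θ)) := ⟨_, rfl⟩
  obtain ⟨J₁, hJ₁⟩ : ∃ J, J = ∫ θ in (0 : ℝ)..Real.pi,
    1 / √(-(m + r * Real.cos θ)) / (m + r * Real.cos θ - 1 / a ^ 2) := ⟨_, rfl⟩
  have hsum : ∫ θ in (0 : ℝ)..Real.pi, (1 / √(-(m + r * Real.cos θ)) + 1 / a ^ 2 *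
      (1 / √(-(m + r * Real.cos θ)) / (m + r * Real.cos θ - 1 / a ^ 2))) =
        J₀ + 1 / a ^ 2 * J₁ := by
    rw [intervalIntegral.integral_add (hu.intervalIntegrable _ _)
      (huX'.intervalIntegrable _ _),
      intervalIntegral.integral_const_mul, hJ₀, hJ₁]
  have hpos : 0 < J₀ := by
    rw [hJ₀]
    exact intervalIntegral.intervalIntegral_pos_of_pos (hu.intervalIntegrable _ _)
      (fun θ => one_div_pos.2 (hs θ)) Real.pi_pos
  -- The combined integrand is `X / (X - a⁻²)` times a positive factor, and both `X` and `X - a⁻²`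
  -- are negative.
  have hnonneg : 0 ≤ J₀ + 1 / a ^ 2 * J₁ := by
    rw [← hsum]
    refine intervalIntegral.integral_nonneg Real.pi_pos.le fun θ _ => ?_
    have e : 1 / √(-(m + r * Real.cos θ)) + 1 / a ^ 2 *
        (1 / √(-(m + r * Real.cos θ)) / (m + r * Real.cos θ - 1 / a ^ 2)) =
        1 / √(-(m + r * Real.cos θ)) *
          ((m + r * Real.cos θ) / (m + r * Real.cos θ - 1 / a ^ 2)) := by
      have h2 := (hXp θ).ne
      have h3 : m + r * Real.cos θ = (m + r * Real.cos θ - 1 / a ^ 2) + 1 / a ^ 2 := by ring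
      rw [show (m + r * Real.cos θ) / (m + r * Real.cos θ - 1 / a ^ 2) =
        1 + 1 / a ^ 2 / (m + r * Real.cos θ - 1 / a ^ 2) by
          rw [eq_comm, eq_div_iff h2, add_mul, div_mul_cancel₀ _ h2]; ring]
      ring
    rw [e]
    exact mul_nonneg (one_div_pos.2 (hs θ)).le (div_nonneg_of_nonpos (hX θ).le (hXp θ).le)
  have hg := AztecFlow.gamma₁_mul ha hα hα1 hr hx₂ hA h1 hd htors hJ₀ hJ₁ hpos hnonneg
  rw [intervalIntegral.integral_const_mul, ← hJ₁] at I1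
  rw [intervalIntegral.integral_const_mul, hsum] at I2
  have hk : 1 / 2 * (a ^ 2 + 1) * (α + 1 / α) = a * AztecFlow.yScale a α := by
    unfold AztecFlow.yScale
    field_simp
  -- After eliminating `g₂`, the terms `g₁ * J₁` cancel since `a² * (1 / a²) = 1`. What remains is
  -- linear in `g₁` with coefficient `a * J₀ > 0`, which also yields uniqueness.
  have hrel : ∀ g₁ g₂ : ℝ, g₂ + a ^ 2 * g₁ = -(1 / 2) * (a ^ 2 + 1) * (α + 1 / α) →
      (g₁ * (-1 / (2 * a) * J₁) = -g₂ * (-1 / (2 * a) * (J₀ + 1 / a ^ 2 * J₁)) ↔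
        g₁ * (a * J₀) = -AztecFlow.yScale a α * (J₀ + 1 / a ^ 2 * J₁)) := by
    intro g₁ g₂ h
    obtain rfl : g₂ = -(a * AztecFlow.yScale a α) - a ^ 2 * g₁ := by linarith
    have e : g₁ * (-1 / (2 * a) * J₁) - -(-(a * AztecFlow.yScale a α) - a ^ 2 * g₁) *
        (-1 / (2 * a) * (J₀ + 1 / a ^ 2 * J₁)) =
        (1 / 2) * (g₁ * (a * J₀) - -AztecFlow.yScale a α * (J₀ + 1 / a ^ 2 * J₁)) := by
      field_simp
      ring
    constructor <;> intro h' <;> linarith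
  have hγ : AztecFlow.gamma₂ ha hα hα1 d + a ^ 2 * AztecFlow.gamma₁ ha hα hα1 d =
      -(1 / 2) * (a ^ 2 + 1) * (α + 1 / α) := by
    unfold AztecFlow.gamma₂
    ring
  refine ⟨fun x hx => ?_, int1, int2, ?_, fun g₁ g₂ h h' => ?_⟩
  · have hx0 : x < 0 := hx.2.trans hx₂
    rw [hR hx0]
    have : 0 < r ^ 2 - (x - m) ^ 2 := by nlinarith [hx.1, hx.2]
    have : 0 < -x := by linarith
    positivity
  · rw [I1, I2]
    exact (hrel _ _ hγ).2 hg
  · rw [I1, I2] at h'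
    have h₁ : g₁ = AztecFlow.gamma₁ ha hα hα1 d :=
      mul_right_cancel₀ (mul_pos ha hpos).ne' (((hrel _ _ h).1 h').trans hg.symm)
    refine ⟨h₁, ?_⟩
    rw [h₁] at h
    linarith
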